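/- Let $(Y,\nu)$ be a standard Borel space with a $\sigma$-finite measure, $P:Y\to Y$ an automorphism of $(Y,\nu)$ (an invertible bimeasurable $\nu$-preserving map), and $r:Y\to[0,\infty)$ a measurable $\nu$-integrable function. Let $X=\{(y,s): y\in Y,\ 0\le s<r(y)\}$, let $\mu$ be the restriction of $\nu\times\mathrm{Lebesgue}$ to $X$, and let $(T_t)_{t\in\mathbb R}$ be the special flow over $P$ with roof function $r$: the point $(y,s)$ moves vertically upward with unit speed, and the points $(y,r(y))$ are identified with $(P(y),0)$. (Points whose vertical motion is not defined for all $t\in\mathbb R$ are kept fixed.) Suppose that the flow $T_t$ is ergodic with respect to $\mu$. Let $f:X\to\mathbb R$ be a $\mu$-integrable function with $\int_X f\,d\mu=0$, and let $A\subset X$ be a $\mu$-measurable set with $\mu(A)>0$. Then for $\mu$-almost every $x\in A$ with $f(x)\neq 0$ the function $s\mapsto f(T_sx)$ is integrable on every bounded interval, and there is a sequence of times $t_k\to+\infty$ such that for all $k$ $$\int_0^{t_k} f(T_sx)\,ds=0\quad\text{and}\quad T_{t_k}x\in A .$$ -/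

import Mathlib

open MeasureTheory Filter Set

/-- The data of a special flow over a base `(Y, ν)`: an automorphism `base` of `(Y, ν)` and a
non-negative integrable roof function `roof`. -/
structure SpecialFlow {Y : Type*} [MeasurableSpace Y] (ν : Measure Y) where
  /-- the base automorphism, an invertible bimeasurable map -/
  base : Y ≃ᵐ Y
  measurePreserving_base : MeasurePreserving base ν ν
  /-- the roof function -/
  roof : Y → ℝ
  measurable_roof : Measurable roof
  roof_nonneg : ∀ y, 0 ≤ roof y
  integrable_roof : Integrable roof ν

namespace SpecialFlow

variable {Y : Type*} [MeasurableSpace Y] {ν : Measure Y} (F : SpecialFlow ν)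

/-- The `n`-th iterate, `n ∈ ℤ`, of the base automorphism. -/
def iter (n : ℤ) : Equiv.Perm Y := (F.base.toEquiv : Equiv.Perm Y) ^ n

/-- The region `{(y, s) | 0 ≤ s < roof y}` under the graph of the roof function. The upper boundary
point `(y, roof y)` is glued to `(base y, 0)` and is therefore left out. -/
def phaseSpace : Set (Y × ℝ) := {p | 0 ≤ p.2 ∧ p.2 < F.roof p.1}

/-- The phase space as a type, with the measurable structure of a subset of `Y × ℝ`. -/
abbrev Phase : Type _ := F.phaseSpace

/-- The measure on the phase space of the special flow: the restriction of `ν × Lebesgue` to the phase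
space. -/
noncomputable def phaseMeasure : Measure F.Phase :=
  (ν.prod (volume : Measure ℝ)).comap (Subtype.val : F.Phase → Y × ℝ)

/-- The cocycle of roof sums: `roof y + ⋯ + roof (base^(n-1) y)` for `n ≥ 0`, and
`-(roof (base^n y) + ⋯ + roof (base^(-1) y))` for `n < 0`. A point that starts from `(y, 0)` and
moves up with unit speed reaches the floor over `base^n y` at time `roofSum n y`. -/
noncomputable def roofSum (n : ℤ) (y : Y) : ℝ :=
  ∑ i ∈ Finset.Ico 0 n, F.roof (F.iter i y) - ∑ i ∈ Finset.Ico n 0, F.roof (F.iter i y)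

/-- The vertical motion through `y` runs for all times, in the past and in the future: the
intervals `[roofSum n y, roofSum (n + 1) y)` cover the line, that is, the roof sums along the orbit
of `y` diverge in both directions. -/
def Complete (y : Y) : Prop :=
  ∀ u : ℝ, ∃ n : ℤ, F.roofSum n y ≤ u ∧ u < F.roofSum (n + 1) y

theorem roofSum_zero (y : Y) : F.roofSum 0 y = 0 := by simp [roofSum]

theorem roofSum_succ (n : ℤ) (y : Y) :
    F.roofSum (n + 1) y = F.roofSum n y + F.roof (F.iter n y) := by
  unfold roofSum
  rcases le_or_gt 0 n with h | h
  · rw [Finset.Ico_eq_empty_of_le (a := n + 1) (by lia), Finset.Ico_eq_empty_of_le (a := n) h,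
      Finset.sum_empty, ← Finset.insert_Ico_right_eq_Ico_add_one h, Finset.sum_insert (by simp)]
    ring
  · rw [Finset.Ico_eq_empty_of_le (b := n + 1) (by lia),
      Finset.Ico_eq_empty_of_le (b := n) h.le, ← Finset.insert_Ico_add_one_left_eq_Ico h,
      Finset.sum_insert (by simp)]
    simp

theorem iter_add (n m : ℤ) (y : Y) : F.iter (n + m) y = F.iter m (F.iter n y) := by
  simp only [iter]
  rw [add_comm, zpow_add, Equiv.Perm.mul_apply]

theorem roofSum_add (n m : ℤ) (y : Y) :
    F.roofSum (n + m) y = F.roofSum n y + F.roofSum m (F.iter n y) := by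
  induction m using Int.induction_on with
  | zero => simp [roofSum_zero]
  | succ i ih =>
    rw [← add_assoc, roofSum_succ, roofSum_succ, ih, iter_add]; ring
  | pred i ih =>
    have h1 := F.roofSum_succ (n + (-(i : ℤ) - 1)) y
    have h2 := F.roofSum_succ (-(i : ℤ) - 1) (F.iter n y)
    rw [show n + (-(i : ℤ) - 1) + 1 = n + -i by ring, iter_add] at h1
    rw [show (-(i : ℤ) - 1) + 1 = -i by ring] at h2
    linarith

theorem roofSum_mono (y : Y) : Monotone fun n : ℤ => F.roofSum n y :=
  monotone_int_of_le_succ fun n => by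
    have := F.roof_nonneg (F.iter n y)
    simp only [roofSum_succ]; linarith

theorem index_unique {y : Y} {u : ℝ} {n m : ℤ}
    (hn : F.roofSum n y ≤ u ∧ u < F.roofSum (n + 1) y)
    (hm : F.roofSum m y ≤ u ∧ u < F.roofSum (m + 1) y) : n = m := by
  rcases lt_trichotomy n m with h | h | h
  · have := F.roofSum_mono y (show n + 1 ≤ m by lia)
    simp only at this; linarith
  · exact h
  · have := F.roofSum_mono y (show m + 1 ≤ n by lia)
    simp only at this; linarith

theorem Complete.iter {y : Y} (h : F.Complete y) (n : ℤ) : F.Complete (F.iter n y) := by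
  intro u
  obtain ⟨m, h1, h2⟩ := h (u + F.roofSum n y)
  refine ⟨m - n, ?_, ?_⟩
  · have := F.roofSum_add n (m - n) y
    rw [show n + (m - n) = m by ring] at this; linarith
  · have := F.roofSum_add n (m - n + 1) y
    rw [show n + (m - n + 1) = m + 1 by ring] at this; linarith

open Classical in
/-- The special flow: for time `t` the point `(y, s)` moves vertically upward to `(y, s + t)`, where
each time it reaches the roof at `(y', roof y')` it continues from `(base y', 0)`; so it arrives at
`(base^n y, s + t - roofSum n y)` with the unique `n` for which this is a point of the phase space.
Points whose vertical motion does not run for all times (a null set for an ergodic flow) are kept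
fixed. -/
noncomputable def move (t : ℝ) (x : F.Phase) : F.Phase :=
  if h : F.Complete x.1.1 then
    ⟨(F.iter (h (x.1.2 + t)).choose x.1.1,
      x.1.2 + t - F.roofSum (h (x.1.2 + t)).choose x.1.1), by
        have := (h (x.1.2 + t)).choose_spec
        rw [roofSum_succ] at this
        constructor <;> simp only <;> linarith⟩
  else x

theorem move_of_not_complete (t : ℝ) {x : F.Phase} (h : ¬ F.Complete x.1.1) : F.move t x = x :=
  dif_neg h

/-- Characterization of the flow on complete orbits. -/
theorem move_val {t : ℝ} {x : F.Phase} (h : F.Complete x.1.1) {n : ℤ}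
    (hn : F.roofSum n x.1.1 ≤ x.1.2 + t ∧ x.1.2 + t < F.roofSum (n + 1) x.1.1) :
    (F.move t x).1 = (F.iter n x.1.1, x.1.2 + t - F.roofSum n x.1.1) := by
  have e := F.index_unique (h (x.1.2 + t)).choose_spec hn
  rw [move, dif_pos h]
  simp only [e]

/-- The special flow is an action of the additive group `ℝ`; `t +ᵥ x` is the position of `x` at
time `t`. -/
noncomputable instance : AddAction ℝ F.Phase where
  vadd := F.move
  zero_vadd x := by
    change F.move 0 x = x
    by_cases h : F.Complete x.1.1
    · refine Subtype.ext ?_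
      have hx : 0 ≤ x.1.2 ∧ x.1.2 < F.roof x.1.1 := x.2
      rw [F.move_val h (n := 0) (by
        rw [roofSum_succ, roofSum_zero]; simp only [SpecialFlow.iter, zpow_zero, Equiv.Perm.one_apply]
        constructor <;> linarith [hx.1, hx.2]), roofSum_zero]
      simp [SpecialFlow.iter]
    · exact F.move_of_not_complete 0 h
  add_vadd s t x := by
    change F.move (s + t) x = F.move s (F.move t x)
    by_cases h : F.Complete x.1.1
    · refine Subtype.ext ?_
      obtain ⟨n, hn⟩ := h (x.1.2 + t)
      have e := F.move_val h hn
      have h' : F.Complete (F.move t x).1.1 := by rw [e]; exact h.iter F n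
      obtain ⟨m, hm⟩ := h' ((F.move t x).1.2 + s)
      rw [F.move_val h' hm]
      rw [e] at hm ⊢
      simp only at hm ⊢
      have a1 := F.roofSum_add n m x.1.1
      have a2 := F.roofSum_add n (m + 1) x.1.1
      rw [← add_assoc] at a2
      rw [F.move_val h (n := n + m) (by constructor <;> linarith [hm.1, hm.2]), iter_add, a1]
      ext
      · rfl
      · simp only; ring
    · rw [F.move_of_not_complete _ h, F.move_of_not_complete t h, F.move_of_not_complete s h]

end SpecialFlow

/-! The argument works for any measurable ergodic flow with a finite invariant measure; the special
flow only has to be shown to be one. Let `D` be the set of points of `A` that never return to `A`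
with zero integral after time `N`. Along an orbit put `φ t = orbitIntegral f x t`. Two times in `D`
with equal values of `φ` are at most `N` apart, and at least some `δ` apart if `A` lies in a set
`linearGrowth f k`. So `φ` is boundedly many-to-one on these times, and the area formula bounds the
integral of `|f|` over them by a constant times `sup |φ|` (`lintegral_enorm_deriv_le`).

By ergodicity `f` is an `L¹` limit of functions with bounded orbit integrals
(`exists_boundedOrbitIntegral_lintegral_sub_le`), so on average `sup |φ|` over `[0, T)` is `o(T)`.
Integrating over the space gives `T ∫_D |f| ≤ o(T)`; hence `f = 0` almost everywhere on `D`
(`ae_mem_zeroReturn`). -/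

namespace SpecialFlow

variable {Y : Type*} [MeasurableSpace Y] {ν : Measure Y} (F : SpecialFlow ν)

/-! ### The special flow is a measurable action on a finite standard Borel space. -/

theorem measurable_iter (n : ℤ) : Measurable (F.iter n) := by
  induction n using Int.induction_on with
  | zero => simpa [iter] using measurable_id
  | succ i ih =>
    have : ⇑(F.iter (i + 1)) = fun y => F.base (F.iter i y) := by
      funext y; rw [iter_add]; simp [iter]
    rw [this]; exact F.base.measurable.comp ih
  | pred i ih =>
    have : ⇑(F.iter (-i - 1)) = fun y => F.base.symm (F.iter (-i) y) := by
      funext y; rw [sub_eq_add_neg, iter_add]; simp [iter]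
    rw [this]; exact F.base.symm.measurable.comp ih

theorem measurable_roofSum (n : ℤ) : Measurable (F.roofSum n) := by
  unfold roofSum
  exact (Finset.measurable_sum _ fun i _ => F.measurable_roof.comp (F.measurable_iter i)).sub
    (Finset.measurable_sum _ fun i _ => F.measurable_roof.comp (F.measurable_iter i))

/-- Countably many heights suffice, which makes completeness a measurable condition. -/
theorem complete_iff (y : Y) :
    F.Complete y ↔ ∀ q : ℤ, ∃ n : ℤ, F.roofSum n y ≤ q ∧ q < F.roofSum (n + 1) y := by
  refine ⟨fun h q => h q, fun h u => ?_⟩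
  obtain ⟨n, hn, -⟩ := h ⌊u⌋
  obtain ⟨m, -, hm⟩ := h (⌊u⌋ + 1)
  have hnu : F.roofSum n y ≤ u := hn.trans (Int.floor_le u)
  have hmu : u < F.roofSum (m + 1) y := by
    push_cast at hm; exact (Int.lt_floor_add_one u).trans hm
  obtain ⟨k, hk, hmax⟩ := Int.exists_greatest_of_bdd (P := fun k => F.roofSum k y ≤ u)
    ⟨m + 1, fun z hz => by
      by_contra! hlt
      have := F.roofSum_mono y hlt.le
      simp only at this; linarith⟩ ⟨n, hnu⟩
  refine ⟨k, hk, ?_⟩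
  by_contra! hle
  have := hmax _ hle
  lia

theorem measurableSet_complete : MeasurableSet {y | F.Complete y} := by
  simp only [complete_iff, ofPred_forall, ofPred_exists, ofPred_and]
  exact MeasurableSet.iInter fun q => MeasurableSet.iUnion fun n =>
    (measurableSet_le (F.measurable_roofSum n) measurable_const).inter
      (measurableSet_lt measurable_const (F.measurable_roofSum (n + 1)))

/-- On each of the countably many pieces with a fixed number of roof crossings the flow is an
explicit measurable map. -/
instance : MeasurableVAdd₂ ℝ F.Phase where
  measurable_vadd := by
    have hy : Measurable fun p : ℝ × F.Phase => p.2.1.1 :=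
      measurable_fst.comp (measurable_subtype_coe.comp measurable_snd)
    have hs : Measurable fun p : ℝ × F.Phase => p.2.1.2 + p.1 :=
      (measurable_snd.comp (measurable_subtype_coe.comp measurable_snd)).add measurable_fst
    refine Measurable.subtype_mk (f := fun p : ℝ × F.Phase => (F.move p.1 p.2).1) ?_
    intro S hS
    let G : ℤ → Set (ℝ × F.Phase) := fun n =>
      {p | F.Complete p.2.1.1 ∧
        F.roofSum n p.2.1.1 ≤ p.2.1.2 + p.1 ∧ p.2.1.2 + p.1 < F.roofSum (n + 1) p.2.1.1}
    have hG (n : ℤ) : MeasurableSet (G n) :=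
      (F.measurableSet_complete.preimage hy).inter
        ((measurableSet_le ((F.measurable_roofSum n).comp hy) hs).inter
          (measurableSet_lt hs ((F.measurable_roofSum (n + 1)).comp hy)))
    have key : (fun p : ℝ × F.Phase => (F.move p.1 p.2).1) ⁻¹' S =
        ({p | ¬ F.Complete p.2.1.1} ∩ (fun p => p.2.1) ⁻¹' S) ∪
        ⋃ n, G n ∩ (fun p => (F.iter n p.2.1.1, p.2.1.2 + p.1 - F.roofSum n p.2.1.1)) ⁻¹' S := by
      ext p
      simp only [mem_preimage, mem_union, mem_inter_iff, mem_ofPred_eq, mem_iUnion, G]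
      by_cases h : F.Complete p.2.1.1
      · obtain ⟨n, hn⟩ := h (p.2.1.2 + p.1)
        rw [F.move_val h hn]
        constructor
        · intro hp; exact Or.inr ⟨n, ⟨h, hn⟩, hp⟩
        · rintro (⟨hc, -⟩ | ⟨m, ⟨-, hm⟩, hp⟩)
          · exact absurd h hc
          · rwa [F.index_unique hn hm]
      · rw [F.move_of_not_complete _ h]
        simp [h]
    rw [key]
    refine MeasurableSet.union
      ((F.measurableSet_complete.preimage hy).compl.inter
        (hS.preimage (measurable_subtype_coe.comp measurable_snd)))
      (MeasurableSet.iUnion fun n => (hG n).inter (hS.preimage ?_))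
    exact ((F.measurable_iter n).comp hy).prodMk (hs.sub ((F.measurable_roofSum n).comp hy))

theorem measurableSet_phaseSpace : MeasurableSet F.phaseSpace :=
  (measurableSet_le measurable_const measurable_snd).inter
    (measurableSet_lt measurable_snd (F.measurable_roof.comp measurable_fst))

instance : IsFiniteMeasure F.phaseMeasure := by
  refine ⟨?_⟩
  rw [phaseMeasure, comap_subtype_coe_apply F.measurableSet_phaseSpace]
  simp only [image_univ, Subtype.range_coe_subtype, ofPred_mem_eq]
  rw [Measure.prod_apply F.measurableSet_phaseSpace]
  have (y : Y) : Prod.mk y ⁻¹' F.phaseSpace = Ico 0 (F.roof y) := rfl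
  simp only [this, Real.volume_Ico, sub_zero]
  exact F.integrable_roof.lintegral_lt_top

instance [StandardBorelSpace Y] : StandardBorelSpace F.Phase :=
  F.measurableSet_phaseSpace.standardBorel

end SpecialFlow

namespace MeasurableFlow

open scoped ENNReal InnerProductSpace Topology

/-! ### Approximation by functions with bounded orbit integrals. -/

section Approximation

variable {X : Type*} [MeasurableSpace X] [AddAction ℝ X]

/-- The integral of `f` along the orbit segment of `x` of duration `t`. -/
noncomputable def orbitIntegral (f : X → ℝ) (x : X) (t : ℝ) : ℝ := ∫ s in (0 : ℝ)..t, f (s +ᵥ x)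

section Measurability

variable [MeasurableVAdd₂ ℝ X]

theorem measurable_flow : Measurable fun p : X × ℝ => p.2 +ᵥ p.1 :=
  measurable_snd.vadd measurable_fst

theorem intervalIntegrable_of_bounded {g : X → ℝ} (hg : Measurable g) {C : ℝ}
    (hC : ∀ x, |g x| ≤ C) (x : X) (a b : ℝ) :
    IntervalIntegrable (fun s : ℝ => g (s +ᵥ x)) volume a b := by
  rw [intervalIntegrable_iff]
  exact Measure.integrableOn_of_bounded (M := C) (by simp)
    (hg.comp (measurable_vadd_const x)).aestronglyMeasurable
    (Eventually.of_forall fun s => hC (s +ᵥ x))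

end Measurability

/-- The bounded measurable functions whose orbit integrals are bounded. -/
def boundedOrbitIntegral (X : Type*) [MeasurableSpace X] [AddAction ℝ X] [MeasurableVAdd₂ ℝ X] :
    Submodule ℝ (X → ℝ) where
  carrier := {u | Measurable u ∧ (∃ C, ∀ x, |u x| ≤ C) ∧ ∃ C, ∀ x t, |orbitIntegral u x t| ≤ C}
  zero_mem' := ⟨measurable_const, ⟨0, by simp⟩, 0, by simp [orbitIntegral]⟩
  add_mem' := by
    rintro u v ⟨hu, ⟨B, hB⟩, C, hC⟩ ⟨hv, ⟨B', hB'⟩, C', hC'⟩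
    refine ⟨hu.add hv, ⟨B + B', fun x => (abs_add_le _ _).trans (add_le_add (hB x) (hB' x))⟩,
      C + C', fun x t => ?_⟩
    have : orbitIntegral (u + v) x t = orbitIntegral u x t + orbitIntegral v x t :=
      intervalIntegral.integral_add (intervalIntegrable_of_bounded hu hB x 0 t)
        (intervalIntegrable_of_bounded hv hB' x 0 t)
    rw [this]
    exact (abs_add_le _ _).trans (add_le_add (hC x t) (hC' x t))
  smul_mem' := by
    rintro c u ⟨hu, ⟨B, hB⟩, C, hC⟩
    refine ⟨hu.const_smul c, ⟨|c| * B, fun x => ?_⟩, |c| * C, fun x t => ?_⟩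
    · rw [Pi.smul_apply, smul_eq_mul, abs_mul]
      exact mul_le_mul_of_nonneg_left (hB x) (abs_nonneg c)
    · have : orbitIntegral (c • u) x t = c * orbitIntegral u x t :=
        intervalIntegral.integral_const_mul c _
      rw [this, abs_mul]
      exact mul_le_mul_of_nonneg_left (hC x t) (abs_nonneg c)

section Coboundary

variable [MeasurableVAdd₂ ℝ X]

/-- The orbit integral telescopes to two end pieces of length `|τ|`, whatever `t` is. -/
theorem coboundary_mem_boundedOrbitIntegral {g : X → ℝ} (hg : Measurable g) {C : ℝ}
    (hC : ∀ x, |g x| ≤ C) (τ : ℝ) :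
    (fun x => g x - g (τ +ᵥ x)) ∈ boundedOrbitIntegral X := by
  have hgτ : Measurable fun x => g (τ +ᵥ x) := hg.comp (measurable_const_vadd τ)
  refine ⟨hg.sub hgτ, ⟨C + C, fun x => (abs_sub _ _).trans (add_le_add (hC _) (hC _))⟩,
    C * |τ| + C * |τ|, fun x t => ?_⟩
  have hi := intervalIntegrable_of_bounded hg hC x
  have h1 : orbitIntegral (fun x => g x - g (τ +ᵥ x)) x t =
      (∫ s in (0 : ℝ)..τ, g (s +ᵥ x)) - ∫ s in t..(τ + t), g (s +ᵥ x) := by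
    have h2 : (∫ s in (0 : ℝ)..t, g (τ +ᵥ (s +ᵥ x))) = ∫ s in τ..(τ + t), g (s +ᵥ x) := by
      have := intervalIntegral.integral_comp_add_left (fun s : ℝ => g (s +ᵥ x)) τ
        (a := 0) (b := t)
      simpa only [add_vadd, add_zero] using this
    rw [orbitIntegral, intervalIntegral.integral_sub (hi 0 t)
      (intervalIntegrable_of_bounded hgτ (fun y => hC (τ +ᵥ y)) x 0 t), h2,
      intervalIntegral.integral_interval_sub_interval_comm (hi _ _) (hi _ _) (hi _ _)]
  rw [h1]
  have h3 (a b : ℝ) : |∫ s in a..b, g (s +ᵥ x)| ≤ C * |b - a| :=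
    intervalIntegral.norm_integral_le_of_norm_le_const (f := fun s : ℝ => g (s +ᵥ x))
      fun s _ => hC (s +ᵥ x)
  refine (abs_sub _ _).trans (add_le_add ?_ ?_)
  · simpa using h3 0 τ
  · simpa using h3 t (τ + t)

end Coboundary

section Ergodic

variable {μ : Measure X}

/-- The exceptional null set may depend on `τ`; ergodicity applied to preimages of measurable sets
allows this. -/
theorem ae_eq_const_of_forall_comp_ae_eq [ErgodicVAdd ℝ X μ] {φ : X → ℝ}
    (hφ : NullMeasurable φ μ) (h : ∀ τ : ℝ, (fun x => φ (τ +ᵥ x)) =ᵐ[μ] φ) :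
    ∃ c : ℝ, φ =ᵐ[μ] fun _ => c := by
  refine exists_eventuallyEq_const_of_forall_separating MeasurableSet fun U hU => ?_
  have := aeconst_of_forall_preimage_vadd_ae_eq ℝ (s := φ ⁻¹' U) (hφ hU) fun τ => by
    refine ((h τ).mono fun x hx => ?_).set_eq
    simp only [mem_preimage, hx]
  simpa [eventuallyConst_set] using this

variable [MeasurableVAdd₂ ℝ X]

theorem ae_eq_const_of_integral_mul_coboundary_eq_zero [ErgodicVAdd ℝ X μ] {φ : X → ℝ}
    (hφ : Integrable φ μ)
    (h : ∀ U, MeasurableSet U → ∀ τ : ℝ,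
      ∫ x, φ x * (U.indicator 1 x - U.indicator 1 (τ +ᵥ x)) ∂μ = 0) :
    ∃ c : ℝ, φ =ᵐ[μ] fun _ => c := by
  refine ae_eq_const_of_forall_comp_ae_eq hφ.aestronglyMeasurable.aemeasurable.nullMeasurable
    fun τ => ?_
  have hmp := measurePreserving_vadd (-τ) μ
  have hφτ : Integrable (fun x => φ (τ +ᵥ x)) μ :=
    (measurePreserving_vadd τ μ).integrable_comp_of_integrable hφ
  refine hφτ.ae_eq_of_forall_setIntegral_eq _ _ hφ fun U hU _ => ?_
  have hUτ : MeasurableSet ((-τ +ᵥ · : X → X) ⁻¹' U) := measurable_const_vadd _ hU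
  -- With time `-τ`, the change of variables moves the shift from the indicator to `φ (τ +ᵥ x)`.
  have h0 := h U hU (-τ)
  have e1 (x : X) : φ x * (U.indicator 1 x - U.indicator 1 (-τ +ᵥ x)) =
      U.indicator φ x - ((-τ +ᵥ · : X → X) ⁻¹' U).indicator φ x := by
    by_cases h1 : x ∈ U <;> by_cases h2 : -τ +ᵥ x ∈ U <;> simp [h1, h2]
  simp only [e1] at h0
  rw [integral_sub (hφ.indicator hU) (hφ.indicator hUτ), integral_indicator hU, sub_eq_zero] at h0
  rw [h0, ← integral_indicator hU,
    ← hmp.integral_comp (MeasurableEquiv.vadd (-τ)).measurableEmbedding]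
  congr 1
  funext x
  by_cases h2 : -τ +ᵥ x ∈ U <;> simp [h2]

variable [IsFiniteMeasure μ]

/-- A vector orthogonal to all coboundaries of indicators is constant, hence orthogonal to every
mean-zero `g`; so `g` lies in the double orthogonal complement, the closure. -/
theorem exists_boundedOrbitIntegral_eLpNorm_sub_lt [ErgodicVAdd ℝ X μ] {g : X → ℝ}
    (hg : MemLp g 2 μ) (hg0 : ∫ x, g x ∂μ = 0) {ε : ℝ} (hε : 0 < ε) :
    ∃ u ∈ boundedOrbitIntegral X, eLpNorm (g - u) 2 μ < ENNReal.ofReal ε := by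
  let W : Submodule ℝ (Lp ℝ 2 μ) :=
    { carrier := {φ | ∃ u ∈ boundedOrbitIntegral X, φ =ᵐ[μ] u}
      zero_mem' := ⟨0, zero_mem _, Lp.coeFn_zero _ _ _⟩
      add_mem' := by
        rintro φ ψ ⟨u, hu, hφ⟩ ⟨v, hv, hψ⟩
        exact ⟨u + v, add_mem hu hv, (Lp.coeFn_add φ ψ).trans (hφ.add hψ)⟩
      smul_mem' := by
        rintro c φ ⟨u, hu, hφ⟩
        exact ⟨c • u, Submodule.smul_mem _ c hu, (Lp.coeFn_smul c φ).trans (hφ.const_smul c)⟩ }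
  have hmem : hg.toLp g ∈ W.topologicalClosure := by
    rw [← Submodule.orthogonal_orthogonal_eq_closure, Submodule.mem_orthogonal]
    intro φ hφ
    rw [Submodule.mem_orthogonal'] at hφ
    obtain ⟨c, hc⟩ := ae_eq_const_of_integral_mul_coboundary_eq_zero (μ := μ) (φ := φ)
      ((Lp.memLp φ).integrable one_le_two) fun U hU τ => by
        have hB (x : X) : |U.indicator (1 : X → ℝ) x| ≤ 1 := by
          by_cases hx : x ∈ U <;> simp [hx]
        have hu := coboundary_mem_boundedOrbitIntegral
          ((measurable_one (α := ℝ) (β := X)).indicator hU) hB τ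
        obtain ⟨hum, ⟨C, hC⟩, -⟩ := id hu
        have huL := MemLp.of_bound (p := 2) (μ := μ) hum.aestronglyMeasurable C
          (Eventually.of_forall hC)
        have := hφ (huL.toLp _) ⟨_, hu, huL.coeFn_toLp⟩
        rw [L2.inner_def] at this
        rw [← this]
        refine integral_congr_ae ?_
        filter_upwards [huL.coeFn_toLp] with x hx
        rw [hx]
        simp [mul_comm]
    rw [L2.inner_def]
    calc ∫ x, ⟪φ x, hg.toLp g x⟫_ℝ ∂μ = ∫ x, c * g x ∂μ := by
          refine integral_congr_ae ?_
          filter_upwards [hc, hg.coeFn_toLp] with x h1 h2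
          rw [h1, h2]
          simp [mul_comm]
      _ = 0 := by rw [integral_const_mul, hg0, mul_zero]
  obtain ⟨w, ⟨u, hu, hwu⟩, hw⟩ := Metric.mem_closure_iff.1 hmem ε hε
  refine ⟨u, hu, ?_⟩
  rw [← edist_lt_ofReal, Lp.edist_def] at hw
  refine lt_of_eq_of_lt (eLpNorm_congr_ae ?_) hw
  exact (hg.coeFn_toLp.sub hwu).symm

theorem exists_boundedOrbitIntegral_lintegral_sub_le [ErgodicVAdd ℝ X μ] {f : X → ℝ}
    (hf : Integrable f μ) (hf0 : ∫ x, f x ∂μ = 0) {ε : ℝ} (hε : 0 < ε) :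
    ∃ u ∈ boundedOrbitIntegral X, ∫⁻ x, ‖f x - u x‖ₑ ∂μ ≤ ENNReal.ofReal ε := by
  obtain ⟨g, hfg, -⟩ := (memLp_one_iff_integrable.2 hf).exists_simpleFunc_eLpNorm_sub_lt
    ENNReal.one_ne_top (ε := ENNReal.ofReal (ε / 3)) (by simpa using hε)
  have hgi : Integrable g μ := g.integrable_of_isFiniteMeasure
  -- Recentring costs little: since `f` has mean zero, `|m| μ(X)` is at most the `L¹` distance from
  -- `f` to `g`.
  let m : ℝ := ⨍ x, g x ∂μ
  have hgm : MemLp (fun x => g x - m) 2 μ :=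
    (g.memLp_of_isFiniteMeasure 2 μ).sub (memLp_const m)
  -- Hölder constant from `L²` to `L¹`; dividing by `K + 1` below avoids the case `K = 0`.
  let K : ℝ := (μ univ ^ (1 / (1 : ℝ≥0∞).toReal - 1 / (2 : ℝ≥0∞).toReal)).toReal
  have hK : ENNReal.ofReal K = μ univ ^ (1 / (1 : ℝ≥0∞).toReal - 1 / (2 : ℝ≥0∞).toReal) :=
    ENNReal.ofReal_toReal (ENNReal.rpow_ne_top_of_nonneg (by norm_num) (measure_ne_top _ _))
  have hK0 : 0 ≤ K := ENNReal.toReal_nonneg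
  obtain ⟨u, hu, hgu⟩ := exists_boundedOrbitIntegral_eLpNorm_sub_lt hgm
    (integral_sub_average μ g) (ε := ε / 3 / (K + 1)) (by positivity)
  refine ⟨u, hu, ?_⟩
  have hum : AEStronglyMeasurable u μ := hu.1.aestronglyMeasurable
  have h1 : eLpNorm ((fun x => g x - m) - u) 1 μ ≤ ENNReal.ofReal (ε / 3) := by
    refine (eLpNorm_le_eLpNorm_mul_rpow_measure_univ (q := 2) one_le_two
      (hgm.aestronglyMeasurable.sub hum)).trans ?_
    rw [← hK]
    refine (mul_le_mul_left hgu.le _).trans ?_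
    rw [← ENNReal.ofReal_mul (by positivity)]
    refine ENNReal.ofReal_le_ofReal ?_
    rw [div_mul_eq_mul_div, div_le_iff₀ (by positivity)]
    nlinarith
  have h2 : eLpNorm (fun _ : X => m) 1 μ ≤ ENNReal.ofReal (ε / 3) := by
    have hm : ‖m‖ₑ * μ univ = ‖∫ x, g x ∂μ‖ₑ := by
      rw [← measure_smul_average μ g, enorm_smul, mul_comm]
      congr 1
      simp [measureReal_def, Real.enorm_eq_ofReal]
    have hd : ∫ x, g x ∂μ = -∫ x, (f - ⇑g) x ∂μ := by
      simp only [Pi.sub_apply]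
      rw [integral_sub hf hgi, hf0]; ring
    rw [eLpNorm_one_eq_lintegral_enorm, lintegral_const, hm, hd, enorm_neg]
    refine (enorm_integral_le_lintegral_enorm _).trans ?_
    rw [← eLpNorm_one_eq_lintegral_enorm]
    exact hfg.le
  have hsplit : (fun x => f x - u x) =
      (f - ⇑g) + ((fun x => g x - m) - u) + fun _ => m := by
    funext x; simp; ring
  rw [← eLpNorm_one_eq_lintegral_enorm, hsplit]
  have hfgm : AEStronglyMeasurable (f - ⇑g) μ :=
    hf.aestronglyMeasurable.sub g.aestronglyMeasurable
  have hgum := hgm.aestronglyMeasurable.sub hum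
  calc _ ≤ eLpNorm ((f - ⇑g) + ((fun x => g x - m) - u)) 1 μ + eLpNorm (fun _ : X => m) 1 μ :=
        eLpNorm_add_le (hfgm.add hgum) aestronglyMeasurable_const le_rfl
    _ ≤ ENNReal.ofReal (ε / 3) + ENNReal.ofReal (ε / 3) + ENNReal.ofReal (ε / 3) := by
        gcongr
        exact (eLpNorm_add_le hfgm hgum le_rfl).trans (add_le_add hfg.le h1)
    _ = ENNReal.ofReal ε := by
        rw [← ENNReal.ofReal_add (by positivity) (by positivity),
          ← ENNReal.ofReal_add (by positivity) (by positivity)]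
        congr 1; ring

end Ergodic

end Approximation

/-- `S` splits into `M` pieces on which `φ` is injective; on each, the area formula turns the
integral into the length of an image contained in `[-B, B]`. -/
theorem lintegral_enorm_deriv_le {φ φ' : ℝ → ℝ} (hφ' : Measurable φ')
    (hd : ∀ᵐ t, HasDerivAt φ (φ' t) t) {S : Set ℝ} (hS : MeasurableSet S) {δ N : ℝ} (hδ : 0 < δ)
    {M : ℕ} (hM : 0 < M) (hN : N ≤ (M - 1) * δ)
    (hsep : ∀ t ∈ S, ∀ t' ∈ S, t < t' → φ t = φ t' → δ ≤ t' - t ∧ t' - t ≤ N)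
    {B : ℝ≥0∞} (hB : ∀ t ∈ S, ‖φ t‖ₑ ≤ B) :
    ∫⁻ t in S, ‖φ' t‖ₑ ≤ M * (2 * B) := by
  let G : Set ℝ := {t | DifferentiableAt ℝ φ t} ∩ {t | deriv φ t = φ' t}
  have hG : MeasurableSet G :=
    (measurableSet_of_differentiableAt ℝ φ).inter (measurableSet_eq_fun (measurable_deriv φ) hφ')
  have hGae : ∀ᵐ t, t ∈ G := hd.mono fun t ht => ⟨ht.differentiableAt, ht.deriv⟩
  -- Cells of length `δ` are coloured modulo `M`. Equal values at one colour would lie in distinct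
  -- cells, so at least `M` cells apart, a gap exceeding `(M - 1) * δ ≥ N`.
  let P : Fin M → Set ℝ := fun j => {t | ⌊t / δ⌋ % (M : ℤ) = j}
  have hP (j : Fin M) : MeasurableSet (P j) :=
    (Int.measurable_floor.comp (measurable_id.div_const δ))
      (MeasurableSet.of_discrete (s := {n : ℤ | n % (M : ℤ) = j}))
  have hM' : (0 : ℤ) < M := by exact_mod_cast hM
  have hcover : S ∩ G ⊆ ⋃ j, (S ∩ G) ∩ P j := by
    intro t ht
    have h0 := Int.emod_nonneg ⌊t / δ⌋ hM'.ne'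
    have h1 := Int.emod_lt_of_pos ⌊t / δ⌋ hM'
    refine mem_iUnion.2 ⟨⟨(⌊t / δ⌋ % (M : ℤ)).toNat, by lia⟩, ht, ?_⟩
    simp only [P, mem_ofPred_eq]
    lia
  have hsep' (j : Fin M) : ∀ t ∈ S ∩ P j, ∀ t' ∈ S ∩ P j, t < t' → φ t ≠ φ t' := by
    intro t ht t' ht' hlt heq
    obtain ⟨h1, h2⟩ := hsep t ht.1 t' ht'.1 hlt heq
    have hj : ⌊t / δ⌋ % (M : ℤ) = ⌊t' / δ⌋ % (M : ℤ) := ht.2.trans ht'.2.symm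
    have h1' : t / δ + 1 ≤ t' / δ := by
      rw [div_add_one hδ.ne']; gcongr; linarith
    have hlt' : ⌊t / δ⌋ < ⌊t' / δ⌋ := by
      rw [← Int.add_one_le_iff, Int.le_floor]
      push_cast
      linarith [Int.floor_le (t / δ)]
    have hdvd : (M : ℤ) ∣ ⌊t' / δ⌋ - ⌊t / δ⌋ := Int.ModEq.dvd hj
    have hge : (M : ℤ) ≤ ⌊t' / δ⌋ - ⌊t / δ⌋ := Int.le_of_dvd (by lia) hdvd
    have hge' : (M : ℝ) ≤ ⌊t' / δ⌋ - ⌊t / δ⌋ := by exact_mod_cast hge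
    have h3 : (M : ℝ) - 1 < t' / δ - t / δ := by
      linarith [Int.floor_le (t' / δ), Int.lt_floor_add_one (t / δ)]
    rw [← sub_div, lt_div_iff₀ hδ] at h3
    linarith
  have hpiece (j : Fin M) : ∫⁻ t in (S ∩ G) ∩ P j, ‖φ' t‖ₑ ≤ 2 * B := by
    have hinj : InjOn φ ((S ∩ G) ∩ P j) := by
      intro t ht t' ht' heq
      rcases lt_trichotomy t t' with h | h | h
      · exact absurd heq (hsep' j t ⟨ht.1.1, ht.2⟩ t' ⟨ht'.1.1, ht'.2⟩ h)
      · exact h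
      · exact absurd heq.symm (hsep' j t' ⟨ht'.1.1, ht'.2⟩ t ⟨ht.1.1, ht.2⟩ h)
    have harea := lintegral_image_eq_lintegral_abs_deriv_mul ((hS.inter hG).inter (hP j))
      (f := φ) (f' := φ') (fun t ht => by
        have := ht.1.2.1.hasDerivAt.hasDerivWithinAt (s := (S ∩ G) ∩ P j)
        rwa [ht.1.2.2] at this) hinj fun _ => 1
    simp only [mul_one, lintegral_const, one_mul, Measure.restrict_apply_univ] at harea
    calc ∫⁻ t in (S ∩ G) ∩ P j, ‖φ' t‖ₑ = volume (φ '' ((S ∩ G) ∩ P j)) := by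
          rw [harea]; simp only [Real.enorm_eq_ofReal_abs]
      _ ≤ volume (Metric.closedEBall (0 : ℝ) B) := by
          refine measure_mono ?_
          rintro _ ⟨t, ht, rfl⟩
          simpa [edist_zero_right] using hB t ht.1.1
      _ = 2 * B := Real.volume_closedEBall 0 B
  calc ∫⁻ t in S, ‖φ' t‖ₑ = ∫⁻ t in S ∩ G, ‖φ' t‖ₑ := by
        refine setLIntegral_congr ?_
        filter_upwards [hGae] with t ht
        exact propext ⟨fun h => ⟨h, ht⟩, fun h => h.1⟩
    _ ≤ ∫⁻ t in ⋃ j, (S ∩ G) ∩ P j, ‖φ' t‖ₑ := lintegral_mono_set hcover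
    _ ≤ ∑' j, ∫⁻ t in (S ∩ G) ∩ P j, ‖φ' t‖ₑ := lintegral_iUnion_le _ _
    _ ≤ ∑' _ : Fin M, 2 * B := ENNReal.tsum_le_tsum hpiece
    _ = M * (2 * B) := by simp [tsum_fintype]

/-! ### The orbit integral as a function of time. -/

section OrbitIntegral

variable {X : Type*} [AddAction ℝ X]

theorem measurable_orbitIntegral [MeasurableSpace X] [MeasurableVAdd₂ ℝ X] {f : X → ℝ} (hf : Measurable f) :
    Measurable fun p : X × ℝ => orbitIntegral f p.1 p.2 := by
  have hg : Measurable fun q : (X × ℝ) × ℝ => f (q.2 +ᵥ q.1.1) :=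
    hf.comp (measurable_snd.vadd (measurable_fst.comp measurable_fst))
  have ht : Measurable fun q : (X × ℝ) × ℝ => q.1.2 := measurable_snd.comp measurable_fst
  have hmeas (U : Set ((X × ℝ) × ℝ)) (hU : MeasurableSet U) :
      Measurable fun p : X × ℝ => ∫ s, U.indicator (fun q => f (q.2 +ᵥ q.1.1)) (p, s) :=
    ((hg.indicator hU).stronglyMeasurable.integral_prod_right').measurable
  have h1 := hmeas {q | 0 < q.2 ∧ q.2 ≤ q.1.2}
    ((measurableSet_lt measurable_const measurable_snd).inter (measurableSet_le measurable_snd ht))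
  have h2 := hmeas {q | q.1.2 < q.2 ∧ q.2 ≤ 0}
    ((measurableSet_lt ht measurable_snd).inter (measurableSet_le measurable_snd measurable_const))
  convert! h1.sub h2 using 1
  funext p
  simp only [orbitIntegral, intervalIntegral, Pi.sub_apply]
  rw [← integral_indicator measurableSet_Ioc, ← integral_indicator measurableSet_Ioc]
  rfl

section Regular

variable {f : X → ℝ}

theorem orbitIntegral_add
    (hreg : ∀ x a b, IntervalIntegrable (fun s : ℝ => f (s +ᵥ x)) volume a b)
    (x : X) (t s : ℝ) :
    orbitIntegral f x (t + s) = orbitIntegral f x t + orbitIntegral f (t +ᵥ x) s := by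
  have h : orbitIntegral f (t +ᵥ x) s = ∫ r in t..(t + s), f (r +ᵥ x) := by
    have := intervalIntegral.integral_comp_add_right (fun r : ℝ => f (r +ᵥ x)) t (a := 0) (b := s)
    simp only [add_vadd, zero_add] at this
    rw [orbitIntegral, this, add_comm]
  rw [h]
  exact (intervalIntegral.integral_add_adjacent_intervals (hreg x _ _) (hreg x _ _)).symm

theorem continuous_orbitIntegral
    (hreg : ∀ x a b, IntervalIntegrable (fun s : ℝ => f (s +ᵥ x)) volume a b)
    (x : X) : Continuous (orbitIntegral f x) :=
  intervalIntegral.continuous_primitive (hreg x) 0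

theorem ae_hasDerivAt_orbitIntegral
    (hreg : ∀ x a b, IntervalIntegrable (fun s : ℝ => f (s +ᵥ x)) volume a b)
    (x : X) :
    ∀ᵐ t : ℝ, HasDerivAt (orbitIntegral f x) (f (t +ᵥ x)) t := by
  have h (n : ℕ) := (hreg x (-n) n).ae_hasDerivAt_integral
  filter_upwards [ae_all_iff.2 h] with t ht
  obtain ⟨n, hn⟩ := exists_nat_ge |t|
  have hle : -(n : ℝ) ≤ n := by linarith [abs_nonneg t]
  refine ht n ?_ 0 ?_
  · rw [uIcc_of_le hle]; exact abs_le.1 hn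
  · rw [uIcc_of_le hle]; constructor <;> simp

theorem hasDerivAt_orbitIntegral_zero
    (hreg : ∀ x a b, IntervalIntegrable (fun s : ℝ => f (s +ᵥ x)) volume a b)
    {x : X} {t : ℝ}
    (h : HasDerivAt (orbitIntegral f x) (f (t +ᵥ x)) t) :
    HasDerivAt (orbitIntegral f (t +ᵥ x)) (f (t +ᵥ x)) 0 := by
  have e : orbitIntegral f (t +ᵥ x) = fun s => orbitIntegral f x (t + s) - orbitIntegral f x t := by
    funext s; rw [orbitIntegral_add hreg]; ring
  rw [e]
  refine HasDerivAt.sub_const _ ?_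
  have := HasDerivAt.comp_const_add t 0 (by rwa [add_zero])
  simpa using this

/-- The part from `u` is bounded uniformly in `T`; only the error `f - u` accumulates. -/
theorem enorm_orbitIntegral_le [MeasurableSpace X] [MeasurableVAdd₂ ℝ X]
    (hreg : ∀ x a b, IntervalIntegrable (fun s : ℝ => f (s +ᵥ x)) volume a b)
    {u : X → ℝ} (hu : u ∈ boundedOrbitIntegral X) :
    ∃ C : ℝ, ∀ (x : X) (T t : ℝ), t ∈ Ico 0 T →
      ‖orbitIntegral f x t‖ₑ ≤
        ENNReal.ofReal C + ∫⁻ s in Ico 0 T, ‖f (s +ᵥ x) - u (s +ᵥ x)‖ₑ := by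
  obtain ⟨hum, ⟨B, hB⟩, C, hC⟩ := hu
  refine ⟨C, fun x T t ht => ?_⟩
  have hui := intervalIntegrable_of_bounded hum hB x 0 t
  have h1 : orbitIntegral f x t = orbitIntegral u x t +
      ∫ s in (0 : ℝ)..t, (f (s +ᵥ x) - u (s +ᵥ x)) := by
    rw [intervalIntegral.integral_sub (hreg x 0 t) hui]
    simp only [orbitIntegral]; ring
  rw [h1]
  refine (enorm_add_le _ _).trans (add_le_add ?_ ?_)
  · rw [Real.enorm_eq_ofReal_abs]
    exact ENNReal.ofReal_le_ofReal (hC x t)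
  · rw [intervalIntegral.integral_of_le ht.1]
    refine (enorm_integral_le_lintegral_enorm _).trans (lintegral_mono_set ?_)
    exact fun s hs => ⟨hs.1.le, hs.2.trans_lt ht.2⟩

end Regular

end OrbitIntegral

/-! ### Returns with zero integral. -/

section ZeroReturn

variable {X : Type*} [AddAction ℝ X] {f : X → ℝ}

/-- The points whose orbit integral grows at least linearly, with rate `1 / (k + 1)`, for times
up to `1 / (k + 1)`. -/
def linearGrowth (f : X → ℝ) (k : ℕ) : Set X :=
  {x | ∀ q : ℚ, |(q : ℝ)| < 1 / ((k : ℝ) + 1) →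
    |(q : ℝ)| * (1 / ((k : ℝ) + 1)) ≤ |orbitIntegral f x q|}

/-- This supplies the lower gap `δ`. Rational times keep `linearGrowth` measurable, and continuity
extends its bound to real times. -/
theorem orbitIntegral_ne_zero_of_mem_linearGrowth
    (hreg : ∀ x a b, IntervalIntegrable (fun s : ℝ => f (s +ᵥ x)) volume a b) {k : ℕ} {x : X}
    (hx : x ∈ linearGrowth f k) {t : ℝ} (ht0 : t ≠ 0) (ht : |t| < 1 / ((k : ℝ) + 1)) :
    orbitIntegral f x t ≠ 0 := by
  have hclosed : IsClosed {t : ℝ | |t| * (1 / ((k : ℝ) + 1)) ≤ |orbitIntegral f x t|} :=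
    isClosed_le (by fun_prop) (continuous_orbitIntegral hreg x).abs
  have hopen : IsOpen {t : ℝ | |t| < 1 / ((k : ℝ) + 1)} :=
    isOpen_lt continuous_abs continuous_const
  have hsub : {t : ℝ | |t| < 1 / ((k : ℝ) + 1)} ∩ range ((↑) : ℚ → ℝ) ⊆
      {t : ℝ | |t| * (1 / ((k : ℝ) + 1)) ≤ |orbitIntegral f x t|} := by
    rintro _ ⟨hq, q, rfl⟩
    exact hx q hq
  have hmem := closure_minimal hsub hclosed
    (Dense.open_subset_closure_inter Rat.denseRange_cast hopen ht)
  have hpos : 0 < |t| * (1 / ((k : ℝ) + 1)) := mul_pos (abs_pos.2 ht0) (by positivity)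
  exact abs_pos.1 (hpos.trans_le hmem)

theorem exists_mem_linearGrowth {x : X} (hd : HasDerivAt (orbitIntegral f x) (f x) 0)
    (hx : f x ≠ 0) : ∃ k, x ∈ linearGrowth f k := by
  have hpos : 0 < |f x| / 2 := by positivity
  have h1 := (hasDerivAt_iff_isLittleO.1 hd).bound hpos
  obtain ⟨r, hr, hball⟩ := Metric.eventually_nhds_iff.1 h1
  -- The same `1 / (k + 1)` serves as time radius and as growth rate.
  obtain ⟨k, hk⟩ := exists_nat_one_div_lt (lt_min hr hpos)
  refine ⟨k, fun q hq => ?_⟩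
  have h0 : orbitIntegral f x 0 = 0 := by simp [orbitIntegral]
  have h2 := hball (y := (q : ℝ)) (by
    rw [dist_zero_right, Real.norm_eq_abs]; exact hq.trans (hk.trans_le (min_le_left _ _)))
  simp only [h0, sub_zero, smul_eq_mul, Real.norm_eq_abs] at h2
  have h3 : |(q : ℝ)| * |f x| ≤ |orbitIntegral f x q| + |orbitIntegral f x q - q * f x| := by
    rw [← abs_mul]
    have := abs_sub_abs_le_abs_sub (q * f x) (orbitIntegral f x q)
    rw [abs_sub_comm] at this
    linarith
  have h4 : |(q : ℝ)| * (1 / ((k : ℝ) + 1)) ≤ |(q : ℝ)| * (|f x| / 2) :=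
    mul_le_mul_of_nonneg_left (hk.le.trans (min_le_right _ _)) (abs_nonneg _)
  linarith

variable [MeasurableSpace X] [MeasurableVAdd₂ ℝ X] {μ : Measure X}

theorem lintegral_lintegral_vadd [SFinite μ] [VAddInvariantMeasure ℝ X μ] {h : X → ℝ≥0∞}
    (hh : Measurable h) (S : Set ℝ) :
    ∫⁻ x, (∫⁻ t in S, h (t +ᵥ x)) ∂μ = volume S * ∫⁻ x, h x ∂μ := by
  rw [lintegral_lintegral_swap (f := fun x (t : ℝ) => h (t +ᵥ x)) (hh.comp measurable_flow).aemeasurable]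
  have (t : ℝ) : ∫⁻ x, h (t +ᵥ x) ∂μ = ∫⁻ x, h x ∂μ :=
    (measurePreserving_vadd t μ).lintegral_comp hh
  simp [this, mul_comm]

/-- By Fubini and invariance, `μ B` is the mean time spent in `B` during `[0, 1]`. -/
theorem ae_of_forall_ae_vadd [SFinite μ] [VAddInvariantMeasure ℝ X μ] {B : Set X}
    (hB : MeasurableSet B) (h : ∀ x, ∀ᵐ t : ℝ, t +ᵥ x ∉ B) : ∀ᵐ x ∂μ, x ∉ B := by
  have key := lintegral_lintegral_vadd (μ := μ) (measurable_one.indicator hB) (Icc 0 1)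
  have h0 (x : X) : ∫⁻ t in Icc (0 : ℝ) 1, B.indicator 1 (t +ᵥ x) = 0 := by
    refine (lintegral_congr_ae (ae_restrict_of_ae ?_)).trans (lintegral_zero)
    filter_upwards [h x] with t ht using indicator_of_notMem ht _
  simp only [h0, lintegral_zero, lintegral_indicator_one hB, Real.volume_Icc] at key
  rw [← measure_eq_zero_iff_ae_notMem]
  simpa using key.symm

theorem ae_ae_vadd [SFinite μ] [VAddInvariantMeasure ℝ X μ] {p : X → Prop} (h : ∀ᵐ x ∂μ, p x) :
    ∀ᵐ x ∂μ, ∀ᵐ t : ℝ, p (t +ᵥ x) := by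
  let B := toMeasurable μ {x | ¬ p x}
  have hB : MeasurableSet B := measurableSet_toMeasurable _ _
  have hB0 : μ B = 0 := by rw [measure_toMeasurable]; exact ae_iff.1 h
  have key := lintegral_lintegral_vadd (μ := μ) (measurable_one.indicator hB) univ
  rw [lintegral_indicator_one hB, hB0, mul_zero] at key
  have hm : Measurable fun q : X × ℝ => B.indicator (1 : X → ℝ≥0∞) (q.2 +ᵥ q.1) :=
    (measurable_one.indicator hB).comp measurable_flow
  rw [Measure.restrict_univ, lintegral_eq_zero_iff hm.lintegral_prod_right'] at key
  filter_upwards [key] with x hx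
  have hx' := (lintegral_eq_zero_iff (hm.comp measurable_prodMk_left)).1 hx
  filter_upwards [hx'] with t ht
  by_contra hp
  have : t +ᵥ x ∈ B := subset_toMeasurable μ _ hp
  simp [this] at ht

theorem measurableSet_linearGrowth (hf : Measurable f) (k : ℕ) :
    MeasurableSet (linearGrowth f k) := by
  simp only [linearGrowth, ofPred_forall]
  refine MeasurableSet.iInter fun q => MeasurableSet.iInter fun _ => ?_
  exact measurableSet_le measurable_const
    (((measurable_orbitIntegral hf).comp (measurable_id.prodMk measurable_const)).abs)

/-- Lebesgue differentiation holds at almost every time of each orbit, hence at time `0` for almost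
every point. -/
theorem ae_exists_mem_linearGrowth [SFinite μ] [VAddInvariantMeasure ℝ X μ] (hf : Measurable f)
    (hreg : ∀ x a b, IntervalIntegrable (fun s : ℝ => f (s +ᵥ x)) volume a b) :
    ∀ᵐ x ∂μ, f x ≠ 0 → ∃ k, x ∈ linearGrowth f k := by
  have hB : MeasurableSet ({x | f x ≠ 0} \ ⋃ k, linearGrowth f k) :=
    (hf (measurableSet_singleton 0).compl).diff
      (MeasurableSet.iUnion (measurableSet_linearGrowth hf))
  have hnot (x : X) : ∀ᵐ t : ℝ, t +ᵥ x ∉ {x | f x ≠ 0} \ ⋃ k, linearGrowth f k := by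
    filter_upwards [ae_hasDerivAt_orbitIntegral hreg x] with t ht
    rintro ⟨h0, hk⟩
    exact hk (mem_iUnion.2 (exists_mem_linearGrowth (hasDerivAt_orbitIntegral_zero hreg ht) h0))
  filter_upwards [ae_of_forall_ae_vadd (μ := μ) hB hnot] with x hx hfx
  by_contra hk
  exact hx ⟨hfx, by simpa using hk⟩

/-- The points that return to `A` with orbit integral zero at some time after `N`. -/
def zeroReturn (f : X → ℝ) (A : Set X) (N : ℝ) : Set X :=
  {x | ∃ t : ℝ, N < t ∧ orbitIntegral f x t = 0 ∧ t +ᵥ x ∈ A}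

/-- Projections of Borel sets need not be Borel, but each time cell of length `δ` holds at most one
zero return to `A`; there the projection is injective and Lusin–Souslin applies. -/
theorem measurableSet_zeroReturn [StandardBorelSpace X] (hf : Measurable f)
    (hreg : ∀ x a b, IntervalIntegrable (fun s : ℝ => f (s +ᵥ x)) volume a b) {A : Set X}
    (hA : MeasurableSet A) {k : ℕ} (hAk : A ⊆ linearGrowth f k) (N : ℝ) :
    MeasurableSet (zeroReturn f A N) := by
  let δ : ℝ := 1 / ((k : ℝ) + 1)
  have hδ : 0 < δ := by positivity
  let Q : ℤ → Set (X × ℝ) := fun j =>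
    {p | N < p.2 ∧ orbitIntegral f p.1 p.2 = 0 ∧ p.2 +ᵥ p.1 ∈ A ∧ ⌊p.2 / δ⌋ = j}
  have hQ (j : ℤ) : MeasurableSet (Q j) :=
    (measurableSet_lt measurable_const measurable_snd).inter
      ((measurable_orbitIntegral hf (measurableSet_singleton 0)).inter
        ((measurable_flow hA).inter
          ((Int.measurable_floor.comp (measurable_snd.div_const δ)) (measurableSet_singleton j))))
  have hinj (j : ℤ) : InjOn Prod.fst (Q j) := by
    rintro ⟨x, t⟩ ⟨-, ht, htA, htj⟩ ⟨x', t'⟩ ⟨-, ht', -, htj'⟩ hxx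
    obtain rfl : x = x' := hxx
    simp only at ht htA htj ht' htj'
    by_contra hne
    have htt : t' - t ≠ 0 := fun h => hne (by rw [sub_eq_zero.1 h])
    refine orbitIntegral_ne_zero_of_mem_linearGrowth hreg (hAk htA) htt ?_ ?_
    · have h1 := Int.abs_sub_lt_one_of_floor_eq_floor (htj'.trans htj.symm)
      rwa [← sub_div, abs_div, abs_of_pos hδ, div_lt_one hδ] at h1
    · have := orbitIntegral_add hreg x t (t' - t)
      rw [add_sub_cancel, ht, ht'] at this
      linarith
  have e : zeroReturn f A N = ⋃ j, Prod.fst '' Q j := by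
    ext x
    simp [zeroReturn, Q]
  rw [e]
  exact MeasurableSet.iUnion fun j => (hQ j).image_of_measurable_injOn measurable_fst (hinj j)

theorem ae_mem_zeroReturn [StandardBorelSpace X] [IsFiniteMeasure μ] [ErgodicVAdd ℝ X μ]
    (hf : Measurable f) (hfi : Integrable f μ) (hf0 : ∫ x, f x ∂μ = 0)
    (hreg : ∀ x a b, IntervalIntegrable (fun s : ℝ => f (s +ᵥ x)) volume a b) {A : Set X}
    (hA : MeasurableSet A) {k : ℕ} (hAk : A ⊆ linearGrowth f k) (N : ℝ) :
    ∀ᵐ x ∂μ, x ∈ A → f x ≠ 0 → x ∈ zeroReturn f A N := by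
  let D : Set X := A \ zeroReturn f A N
  have hD : MeasurableSet D := hA.diff (measurableSet_zeroReturn hf hreg hA hAk N)
  let δ : ℝ := 1 / ((k : ℝ) + 1)
  have hδ : 0 < δ := by positivity
  obtain ⟨n, hn⟩ := exists_nat_ge (N / δ)
  let M : ℕ := n + 1
  have hM : N ≤ ((M : ℝ) - 1) * δ := by
    rw [← div_le_iff₀ hδ]; simpa [M] using hn
  have horbit (x : X) (T : ℝ) (B : ℝ≥0∞) (hB : ∀ t ∈ Ico 0 T, ‖orbitIntegral f x t‖ₑ ≤ B) :
      ∫⁻ t in Ico 0 T, D.indicator (fun y => ‖f y‖ₑ) (t +ᵥ x) ≤ M * (2 * B) := by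
    have hDx : MeasurableSet ((· +ᵥ x : ℝ → X) ⁻¹' D) := measurable_vadd_const x hD
    have e : ∫⁻ t in Ico 0 T, D.indicator (fun y => ‖f y‖ₑ) (t +ᵥ x) =
        ∫⁻ t in ((· +ᵥ x : ℝ → X) ⁻¹' D) ∩ Ico 0 T, ‖f (t +ᵥ x)‖ₑ := by
      rw [← setLIntegral_indicator hDx]
      rfl
    rw [e]
    refine lintegral_enorm_deriv_le (hf.comp (measurable_vadd_const x))
      (ae_hasDerivAt_orbitIntegral hreg x) (hDx.inter measurableSet_Ico) hδ (Nat.succ_pos n) hM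
      (fun t ht t' ht' hlt heq => ?_) fun t ht => hB t ht.2
    have h0 : orbitIntegral f (t +ᵥ x) (t' - t) = 0 := by
      have := orbitIntegral_add hreg x t (t' - t)
      rw [add_sub_cancel] at this
      linarith
    constructor
    · by_contra! h
      exact orbitIntegral_ne_zero_of_mem_linearGrowth hreg (hAk ht.1.1) (by linarith)
        (by rwa [abs_of_pos (by linarith)]) h0
    · by_contra! h
      refine ht.1.2 ⟨t' - t, h, h0, ?_⟩
      rw [← add_vadd, sub_add_cancel]
      exact ht'.1.1
  let I : ℝ≥0∞ := ∫⁻ x in D, ‖f x‖ₑ ∂μ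
  -- The orbit bound integrated over the space, with `C` independent of `T`.
  have hbound (ε : ℝ) (hε : 0 < ε) : ∃ C : ℝ, ∀ T : ℝ, 0 ≤ T → ENNReal.ofReal T * I ≤
      M * (2 * (ENNReal.ofReal C * μ univ + ENNReal.ofReal T * ENNReal.ofReal ε)) := by
    obtain ⟨u, hu, hfu⟩ := exists_boundedOrbitIntegral_lintegral_sub_le hfi hf0 hε
    obtain ⟨C, hC⟩ := enorm_orbitIntegral_le hreg hu
    refine ⟨C, fun T hT => ?_⟩
    have hI := lintegral_lintegral_vadd (μ := μ) (hf.enorm.indicator hD) (Ico 0 T)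
    rw [lintegral_indicator hD, Real.volume_Ico, sub_zero] at hI
    have hm : Measurable fun x => ‖f x - u x‖ₑ := (hf.sub hu.1).enorm
    have hJ := lintegral_lintegral_vadd (μ := μ) hm (Ico 0 T)
    rw [Real.volume_Ico, sub_zero] at hJ
    rw [← hI]
    calc _ ≤ ∫⁻ x, M * (2 * (ENNReal.ofReal C +
            ∫⁻ s in Ico 0 T, ‖f (s +ᵥ x) - u (s +ᵥ x)‖ₑ)) ∂μ :=
          lintegral_mono fun x => horbit x T _ (hC x T)
      _ = M * (2 * (ENNReal.ofReal C * μ univ +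
            ENNReal.ofReal T * ∫⁻ x, ‖f x - u x‖ₑ ∂μ)) := by
          rw [lintegral_const_mul' _ _ (by simp), lintegral_const_mul' _ _ (by simp),
            lintegral_add_left measurable_const, lintegral_const, hJ]
      _ ≤ _ := by gcongr
  have hI_top : I ≠ ∞ := by
    refine ne_top_of_le_ne_top hfi.2.ne ?_
    exact setLIntegral_le_lintegral _ _
  have hI0 : I = 0 := by
    by_contra hne
    have hIpos : 0 < I.toReal := ENNReal.toReal_pos hne hI_top
    have hMpos : (0 : ℝ) < M := by exact_mod_cast Nat.succ_pos n
    -- This `ε` makes the error term `T * I / 2`, half of the left side.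
    obtain ⟨C, hC⟩ := hbound (I.toReal / (4 * M)) (by positivity)
    have hreal (T : ℝ) (hT : 0 ≤ T) :
        T * I.toReal ≤ M * (2 * (max C 0 * (μ univ).toReal + T * (I.toReal / (4 * M)))) := by
      have h := ENNReal.toReal_mono (by finiteness) (hC T hT)
      have hε0 : 0 ≤ I.toReal / (4 * M) := by positivity
      rw [ENNReal.toReal_mul, ENNReal.toReal_ofReal hT, ENNReal.toReal_mul, ENNReal.toReal_mul,
        ENNReal.toReal_add (by finiteness) (by finiteness), ENNReal.toReal_mul,
        ENNReal.toReal_mul, ENNReal.toReal_ofReal', ENNReal.toReal_ofReal hT,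
        ENNReal.toReal_ofReal hε0] at h
      simpa using h
    let K : ℝ := M * (2 * (max C 0 * (μ univ).toReal))
    have hK : 0 ≤ K := by positivity
    -- At this `T` the inequality reads `2 * (K + 1) ≤ 2 * K + 1`.
    have h1 := hreal (2 * (K + 1) / I.toReal) (by positivity)
    have h2 : 2 * (K + 1) / I.toReal * I.toReal = 2 * (K + 1) := by field_simp
    have h3 : M * (2 * (max C 0 * (μ univ).toReal +
        2 * (K + 1) / I.toReal * (I.toReal / (4 * M)))) = K + (K + 1) := by
      simp only [K]; field_simp; ring
    rw [h2, h3] at h1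
    linarith
  have hae : ∀ᵐ x ∂μ, x ∈ D → ‖f x‖ₑ = 0 := by
    rw [← ae_restrict_iff' hD]
    exact (lintegral_eq_zero_iff hf.enorm).1 hI0
  filter_upwards [hae] with x hx hxA hfx
  by_contra hret
  exact hfx (by simpa using hx ⟨hxA, hret⟩)

/-- The single-return statement is used for every `A ∩ linearGrowth f k` and every natural `N`, a
countable family. -/
theorem ae_exists_tendsto_zeroReturn [StandardBorelSpace X] [IsFiniteMeasure μ]
    [ErgodicVAdd ℝ X μ] (hf : Measurable f) (hfi : Integrable f μ) (hf0 : ∫ x, f x ∂μ = 0)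
    (hreg : ∀ x a b, IntervalIntegrable (fun s : ℝ => f (s +ᵥ x)) volume a b) {A : Set X}
    (hA : MeasurableSet A) :
    ∀ᵐ x ∂μ, x ∈ A → f x ≠ 0 → ∃ t : ℕ → ℝ, Tendsto t atTop atTop ∧
      ∀ n, orbitIntegral f x (t n) = 0 ∧ t n +ᵥ x ∈ A := by
  have h (k n : ℕ) := ae_mem_zeroReturn hf hfi hf0 hreg
    (hA.inter (measurableSet_linearGrowth hf k)) inter_subset_right n
  filter_upwards [ae_exists_mem_linearGrowth (μ := μ) hf hreg, ae_all_iff.2 fun k =>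
    ae_all_iff.2 (h k)] with x hx hret hxA hfx
  obtain ⟨k, hk⟩ := hx hfx
  choose t ht1 ht2 ht3 using fun n => hret k n ⟨hxA, hk⟩ hfx
  exact ⟨t, tendsto_atTop_mono (fun n => (ht1 n).le) tendsto_natCast_atTop_atTop,
    fun n => ⟨ht2 n, (ht3 n).1⟩⟩

/-! ### Reduction to a Borel function integrable along every orbit. -/

/-- The points along whose orbit `f` is locally integrable. -/
def locallyIntegrableOrbit (f : X → ℝ) : Set X :=
  {x | ∀ n : ℕ, ∫⁻ s in Icc (-n : ℝ) n, ‖f (s +ᵥ x)‖ₑ < ∞}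

theorem mem_locallyIntegrableOrbit_iff (hf : Measurable f) {x : X} :
    x ∈ locallyIntegrableOrbit f ↔
      ∀ a b, IntervalIntegrable (fun s : ℝ => f (s +ᵥ x)) volume a b := by
  have hm := (hf.comp (measurable_vadd_const (M := ℝ) x)).aestronglyMeasurable (μ := volume)
  constructor
  · intro h a b
    obtain ⟨n, hn⟩ := exists_nat_ge (max |a| |b|)
    have hint : IntegrableOn (fun s : ℝ => f (s +ᵥ x)) (Icc (-n : ℝ) n) :=
      ⟨hm.restrict, h n⟩
    refine (hint.mono_set ?_).intervalIntegrable
    exact ordConnected_Icc.uIcc_subset (abs_le.1 ((le_max_left _ _).trans hn))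
      (abs_le.1 ((le_max_right _ _).trans hn))
  · intro h n
    have := (intervalIntegrable_iff_integrableOn_Icc_of_le (by simp)).1 (h (-n : ℝ) n)
    exact this.2

theorem measurableSet_locallyIntegrableOrbit (hf : Measurable f) :
    MeasurableSet (locallyIntegrableOrbit f) := by
  simp only [locallyIntegrableOrbit, ofPred_forall]
  refine MeasurableSet.iInter fun n => measurableSet_lt ?_ measurable_const
  exact (hf.enorm.comp measurable_flow).lintegral_prod_right'

theorem vadd_mem_locallyIntegrableOrbit (hf : Measurable f) {x : X}
    (hx : x ∈ locallyIntegrableOrbit f) (τ : ℝ) : τ +ᵥ x ∈ locallyIntegrableOrbit f := by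
  rw [mem_locallyIntegrableOrbit_iff hf] at hx ⊢
  intro a b
  have := (hx (a + τ) (b + τ)).comp_add_right τ
  simpa [add_vadd] using this

theorem ae_mem_locallyIntegrableOrbit [SFinite μ] [VAddInvariantMeasure ℝ X μ]
    (hf : Measurable f) (hfi : Integrable f μ) : ∀ᵐ x ∂μ, x ∈ locallyIntegrableOrbit f := by
  refine ae_all_iff.2 fun n => ae_lt_top (hf.enorm.comp measurable_flow).lintegral_prod_right' ?_
  refine ne_of_eq_of_ne (lintegral_lintegral_vadd hf.enorm _) ?_
  exact ENNReal.mul_ne_top (by simp) hfi.2.ne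

theorem ae_exists_tendsto_intervalIntegral_eq_zero [StandardBorelSpace X] [IsFiniteMeasure μ]
    [ErgodicVAdd ℝ X μ] (hfi : Integrable f μ) (hf0 : ∫ x, f x ∂μ = 0) {A : Set X}
    (hA : NullMeasurableSet A μ) :
    ∀ᵐ x ∂μ, x ∈ A → f x ≠ 0 →
      (∀ a b : ℝ, IntervalIntegrable (fun s : ℝ => f (s +ᵥ x)) volume a b) ∧
      ∃ t : ℕ → ℝ, Tendsto t atTop atTop ∧
        ∀ k, (∫ s in (0 : ℝ)..t k, f (s +ᵥ x)) = 0 ∧ t k +ᵥ x ∈ A := by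
  obtain ⟨A', hA'A, hA', hAA'⟩ := hA.exists_measurable_subset_ae_eq
  obtain ⟨f', hf', hff'⟩ := hfi.1.aemeasurable
  let R := locallyIntegrableOrbit f'
  have hR : MeasurableSet R := measurableSet_locallyIntegrableOrbit hf'
  -- Since `R` is invariant, `g` agrees with `f'` on whole orbits or vanishes on them, so it is
  -- locally integrable along every orbit.
  let g := R.indicator f'
  have hg : Measurable g := hf'.indicator hR
  have hfg : f =ᵐ[μ] g := by
    filter_upwards [hff', ae_mem_locallyIntegrableOrbit hf' (hfi.congr hff')] with x hx hxR
    rw [hx]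
    exact (indicator_of_mem hxR f').symm
  have hreg (x : X) (a b : ℝ) : IntervalIntegrable (fun s : ℝ => g (s +ᵥ x)) volume a b := by
    by_cases hx : x ∈ R
    · have e : (fun s : ℝ => g (s +ᵥ x)) = fun s : ℝ => f' (s +ᵥ x) := by
        funext s
        exact indicator_of_mem (vadd_mem_locallyIntegrableOrbit hf' hx s) f'
      rw [e]
      exact (mem_locallyIntegrableOrbit_iff hf').1 hx a b
    · have e : (fun s : ℝ => g (s +ᵥ x)) = fun _ => 0 := by
        funext s
        refine indicator_of_notMem (fun hs => hx ?_) f'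
        simpa using vadd_mem_locallyIntegrableOrbit hf' hs (-s)
      rw [e]
      exact intervalIntegrable_const
  have hmain := ae_exists_tendsto_zeroReturn hg (hfi.congr hfg)
    ((integral_congr_ae hfg).symm.trans hf0) hreg hA'
  -- `ae_ae_vadd` gives `f = g` at almost every time of the orbit, so their orbit integrals
  -- coincide.
  filter_upwards [hmain, hfg, ae_ae_vadd hfg, hAA'.mem_iff] with x hx hfx horb hxA hxA0 hfx0
  obtain ⟨t, ht, htk⟩ := hx (hxA.2 hxA0) (hfx ▸ hfx0)
  refine ⟨fun a b => (hreg x a b).congr_ae (ae_restrict_of_ae ?_), t, ht,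
    fun k => ⟨?_, hA'A (htk k).2⟩⟩
  · filter_upwards [horb] with s hs using hs.symm
  · exact (intervalIntegral.integral_congr_ae (horb.mono fun s hs _ => hs)).trans (htk k).1

end ZeroReturn

end MeasurableFlow

theorem theoremA {Y : Type*} [MeasurableSpace Y] [StandardBorelSpace Y]
    (ν : Measure Y) [SigmaFinite ν] (F : SpecialFlow ν)
    (hF : ErgodicVAdd ℝ F.Phase F.phaseMeasure)
    (f : F.Phase → ℝ) (hf : Integrable f F.phaseMeasure)
    (hf0 : ∫ x, f x ∂F.phaseMeasure = 0)
    (A : Set F.Phase) (hA : NullMeasurableSet A F.phaseMeasure)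
    (hA0 : 0 < F.phaseMeasure A) :
    ∀ᵐ x ∂F.phaseMeasure, x ∈ A → f x ≠ 0 →
      (∀ a b : ℝ, IntervalIntegrable (fun s : ℝ => f (s +ᵥ x)) volume a b) ∧
      ∃ t : ℕ → ℝ, Tendsto t atTop atTop ∧
        ∀ k, (∫ s in (0 : ℝ)..t k, f (s +ᵥ x)) = 0 ∧ t k +ᵥ x ∈ A := by
  exact MeasurableFlow.ae_exists_tendsto_intervalIntegral_eq_zero hf hf0 hA
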